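/- Let $\mathbb{C}$ be a ribbon category: a braided monoidal category with braid $\sigma$, a twist $\theta$ (natural isomorphisms $\theta_X\colon X\to X$ with $\theta_{X\otimes Y}=\sigma_{X,Y};(\theta_Y\otimes\theta_X);\sigma_{Y,X}$), and for every object $X$ a chosen dual $X^*$ with unit $\eta_X\colon I\to X\otimes X^*$ and counit $\varepsilon_X\colon X^*\otimes X\to I$ satisfying the snake equations, such that $(\theta_X)^*=\theta_{X^*}$. Here $f;g$ denotes composition in diagrammatic order, and associativity and unit isomorphisms are suppressed. For $f\colon P\otimes X\to Q\otimes X$ let $$\mathrm{Tr}^X_{P,Q}(f)=(P\otimes\eta_X);(f\otimes X^*);\bigl(Q\otimes(\sigma_{X,X^*};(X^*\otimes\theta_X);\varepsilon_X)\bigr)\colon P\to Q .$$ Let $A$ be a reflexive object of $\mathbb{C}$, i.e. an object with an isomorphism $\varphi\colon A\otimes A^*\to A$. Put $$\mathbf{app}=(\varphi^{-1}\otimes A);(A\otimes\varepsilon_A)\colon A\otimes A\to A,$$ $$\mathbf{lam}=(A\otimes\eta_A);(A\otimes A\otimes\theta_{A^*}^{-1});(A\otimes\sigma_{A^*,A}^{-1});(\varphi\otimes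 A)\colon A\to A\otimes A,$$ $$\mathsf{cur}(f)=(X\otimes\eta_A);(f\otimes A^*);\varphi\colon X\to A\qquad(f\colon X\otimes A\to A),$$ $\mathbf{app}_0=\mathbf{lam}_0=\mathrm{id}_A$, $\mathbf{app}_{n+1}=(\mathbf{app}\otimes A^{\otimes n});\mathbf{app}_n\colon A^{\otimes(n+2)}\to A$ and $\mathbf{lam}_{n+1}=\mathbf{lam}_n;(\mathbf{lam}\otimes A^{\otimes n})\colon A\to A^{\otimes(n+2)}$. Let $\mathcal{A}=\mathbb{C}(I,A)$ with application $a\cdot b=(a\otimes b);\mathbf{app}$ and elements $\boldsymbol{B}=\mathsf{cur}(\mathsf{cur}(\mathsf{cur}((A\otimes\mathbf{app});\mathbf{app})))$, $\boldsymbol{I}=\mathsf{cur}(\mathrm{id}_A)$ and $a^\bullet=\mathsf{cur}((A\otimes a);\mathbf{app})$ for $a\in\mathcal{A}$. Write $a\circ b=(\boldsymbol{B}\cdot a)\cdot b$, $a^0=\boldsymbol{I}$, $a^{n+1}=a\circ a^n$. For $m,n\in\mathbb{N}$ let $$\mathcal{I}_{\mathcal{A}}(m,n)=\{a\in\mathcal{A}\mid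 a^\bullet\circ\boldsymbol{B}^{m+1}=(\boldsymbol{B}\cdot a)\circ\boldsymbol{B}^n\}$$ be the set of elements of arity $m\to n$ (the hom-set of the internal PROB of $\mathcal{A}$), and for $f\colon A^{\otimes m}\to A^{\otimes n}$ let $$F(f)=\mathrm{Tr}^A_{I,A}\bigl(\mathbf{lam}_m;(\mathbf{lam}\otimes f);(A\otimes\mathbf{app}_n)\bigr)\in\mathcal{A}.$$ Then, for all $m,n\in\mathbb{N}$ with $m\neq0$ or $n\neq0$, the assignment $f\mapsto F(f)$ is a bijection from $\mathbb{C}(A^{\otimes m},A^{\otimes n})$ onto $\mathcal{I}_{\mathcal{A}}(m,n)$. -/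

import Mathlib

open CategoryTheory MonoidalCategory

universe v u

/-- A balanced monoidal category: a braided monoidal category with a twist, i.e. a natural
isomorphism `θ_X : X ≅ X` such that
`θ_{X ⊗ Y} = σ_{X,Y} ; (θ_Y ⊗ θ_X) ; σ_{Y,X}`. -/
class BalancedMonoidalCategory (C : Type u) [Category.{v} C] [MonoidalCategory C]
    [BraidedCategory C] where
  twist : ∀ X : C, X ≅ X
  twist_naturality : ∀ {X Y : C} (f : X ⟶ Y), f ≫ (twist Y).hom = (twist X).hom ≫ f
  twist_tensor : ∀ X Y : C,
    (twist (X ⊗ Y)).hom =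
      (β_ X Y).hom ≫ ((twist Y).hom ⊗ₘ (twist X).hom) ≫ (β_ Y X).hom

/-- A ribbon category: a balanced monoidal category in which every object `X` has a chosen dual
`X*`, with unit `η_X : I ⟶ X ⊗ X*` and counit `ε_X : X* ⊗ X ⟶ I`, such that
`(θ_X)* = θ_{X*}`.  The dual on this side, which some authors call the left dual, is what Mathlib
calls the right dual `Xᘁ`. -/
class RibbonCategory (C : Type u) [Category.{v} C] [MonoidalCategory C]
    [BraidedCategory C] [RightRigidCategory C] extends BalancedMonoidalCategory C where
  twist_dual : ∀ X : C, rightAdjointMate (twist X).hom = (twist (Xᘁ : C)).hom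

namespace RibbonCategory

variable {C : Type u} [Category.{v} C] [MonoidalCategory C] [BraidedCategory C]
  [RightRigidCategory C] [RibbonCategory C]

/-- The twist isomorphism `θ_X`. -/
def θ (X : C) : X ≅ X := BalancedMonoidalCategory.twist X

/-- The canonical (right) trace `Tr^X_{P,Q} : C(P ⊗ X, Q ⊗ X) → C(P, Q)` of a ribbon category,
`Tr^X(f) = (P ⊗ η_X) ; (f ⊗ X*) ; (Q ⊗ (σ_{X,X*} ; (X* ⊗ θ_X) ; ε_X))`. -/
def trace {P Q : C} (X : C) (f : P ⊗ X ⟶ Q ⊗ X) : P ⟶ Q :=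
  (ρ_ P).inv ≫ P ◁ η_ X (Xᘁ) ≫ (α_ P X (Xᘁ)).inv ≫ f ▷ (Xᘁ) ≫ (α_ Q X (Xᘁ)).hom ≫
    Q ◁ ((β_ X (Xᘁ)).hom ≫ (Xᘁ) ◁ (θ X).hom ≫ ε_ X (Xᘁ)) ≫ (ρ_ Q).hom

/-- The tensor power `A^{⊗ n}`. -/
def tpow (A : C) : ℕ → C
  | 0 => 𝟙_ C
  | n + 1 => A ⊗ tpow A n

variable {A : C}

/-! In what follows a reflexive object is an object `A` with an isomorphism `φ : A ⊗ A* ≅ A`. -/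

/-- `app = (φ⁻¹ ⊗ A) ; (A ⊗ ε_A) : A ⊗ A ⟶ A`. -/
def app (φ : A ⊗ (Aᘁ : C) ≅ A) : A ⊗ A ⟶ A :=
  φ.inv ▷ A ≫ (α_ A (Aᘁ) A).hom ≫ A ◁ ε_ A (Aᘁ) ≫ (ρ_ A).hom

/-- `lam = (A ⊗ η_A) ; (A ⊗ A ⊗ θ⁻¹) ; (A ⊗ σ⁻¹) ; (φ ⊗ A) : A ⟶ A ⊗ A`. -/
def lam (φ : A ⊗ (Aᘁ : C) ≅ A) : A ⟶ A ⊗ A :=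
  (ρ_ A).inv ≫ A ◁ (η_ A (Aᘁ) ≫ A ◁ (θ (Aᘁ : C)).inv ≫ (β_ (Aᘁ : C) A).inv) ≫
    (α_ A (Aᘁ) A).inv ≫ φ.hom ▷ A

/-- Currying `cur(f) = (X ⊗ η_A) ; (f ⊗ A*) ; φ : X ⟶ A` of `f : X ⊗ A ⟶ A`. -/
def cur (φ : A ⊗ (Aᘁ : C) ≅ A) {X : C} (f : X ⊗ A ⟶ A) : X ⟶ A :=
  (ρ_ X).inv ≫ X ◁ η_ A (Aᘁ) ≫ (α_ X A (Aᘁ)).inv ≫ f ▷ (Aᘁ) ≫ φ.hom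

/-- `app_n : A^{⊗(n+1)} ⟶ A`, with `app_0 = id` and `app_{n+1} = (app ⊗ A^{⊗n}) ; app_n`. -/
def appN (φ : A ⊗ (Aᘁ : C) ≅ A) : (n : ℕ) → (A ⊗ tpow A n ⟶ A)
  | 0 => (ρ_ A).hom
  | n + 1 => (α_ A A (tpow A n)).inv ≫ app φ ▷ tpow A n ≫ appN φ n

/-- `lam_n : A ⟶ A^{⊗(n+1)}`, with `lam_0 = id` and `lam_{n+1} = lam_n ; (lam ⊗ A^{⊗n})`. -/
def lamN (φ : A ⊗ (Aᘁ : C) ≅ A) : (n : ℕ) → (A ⟶ A ⊗ tpow A n)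
  | 0 => (ρ_ A).inv
  | n + 1 => lamN φ n ≫ lam φ ▷ tpow A n ≫ (α_ A A (tpow A n)).hom

/-! ### The combinatory algebra `𝒜 = C(I, A)` -/

/-- Application `a · b = (a ⊗ b) ; app`. -/
def dot (φ : A ⊗ (Aᘁ : C) ≅ A) (a b : 𝟙_ C ⟶ A) : 𝟙_ C ⟶ A :=
  (λ_ (𝟙_ C)).inv ≫ (a ⊗ₘ b) ≫ app φ

/-- The combinator `B = cur(cur(cur((A ⊗ app) ; app)))`. -/
def combB (φ : A ⊗ (Aᘁ : C) ≅ A) : 𝟙_ C ⟶ A :=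
  cur φ (cur φ (cur φ
    (((λ_ A).hom ▷ A) ▷ A ≫ (α_ A A A).hom ≫ A ◁ app φ ≫ app φ)))

/-- The combinator `I = cur(id_A)`. -/
def combI (φ : A ⊗ (Aᘁ : C) ≅ A) : 𝟙_ C ⟶ A :=
  cur φ (λ_ A).hom

/-- The element `a^• = cur((A ⊗ a) ; app)`. -/
def bullet (φ : A ⊗ (Aᘁ : C) ≅ A) (a : 𝟙_ C ⟶ A) : 𝟙_ C ⟶ A :=
  cur φ ((λ_ A).hom ≫ (ρ_ A).inv ≫ A ◁ a ≫ app φ)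

/-- `a ∘ b = B · a · b`. -/
def circ (φ : A ⊗ (Aᘁ : C) ≅ A) (a b : 𝟙_ C ⟶ A) : 𝟙_ C ⟶ A :=
  dot φ (dot φ (combB φ) a) b

/-- Powers `a^0 = I` and `a^{n+1} = a ∘ a^n`. -/
def power (φ : A ⊗ (Aᘁ : C) ≅ A) (a : 𝟙_ C ⟶ A) : ℕ → (𝟙_ C ⟶ A)
  | 0 => combI φ
  | n + 1 => circ φ a (power φ a n)

/-- The hom-set `I_𝒜(m, n)` of the internal PROB of `𝒜 = C(I, A)`: the set of all elements `a`
of arity `m → n`, i.e. with `a^• ∘ B^{m+1} = (B · a) ∘ B^n`. -/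
def internalHom (φ : A ⊗ (Aᘁ : C) ≅ A) (m n : ℕ) : Set (𝟙_ C ⟶ A) :=
  {a | circ φ (bullet φ a) (power φ (combB φ) (m + 1)) =
    circ φ (dot φ (combB φ) a) (power φ (combB φ) n)}

/-- The action on morphisms of the functor `F` from the full subcategory on the tensor powers of
`A` to the internal PROB, sending `f : A^{⊗m} ⟶ A^{⊗n}` to
`Tr^A_{I,A}(lam_m ; (lam ⊗ f) ; (A ⊗ app_n)) : I ⟶ A`. -/
def mapF (φ : A ⊗ (Aᘁ : C) ≅ A) (m n : ℕ) (f : tpow A m ⟶ tpow A n) : 𝟙_ C ⟶ A :=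
  trace A ((λ_ A).hom ≫ lamN φ m ≫ (lam φ ⊗ₘ f) ≫ (α_ A A (tpow A n)).hom ≫ A ◁ appN φ n)

end RibbonCategory

/-! An element `a` is determined by t = `uncurN φ m (toEnd φ a)` : A ⊗ A^m ⟶ A, as currying is
bijective. Rotating strands through the twist shows that tracing against lam_n undoes uncurrying
(`trace_lamN_comp_uncurN`), so F(f) is the element with t = (A ⊗ f) ; app_n (`uncurN_toEnd_mapF`).

It remains to see that the t of this form are those of arity m → n, with f unique. Arity says that t
intertwines n-ary composition on A with application (`mem_internalHom_iff`). A split epimorphism Φ :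
A ⊗ (A^n)* ⟶ A turns that composition into application, so with Y = (A^n)* ⊗ A^m the map (Φ ⊗ A^m) ;
t : A ⊗ Y ⟶ A commutes with left application. Through φ this forces the form A ⊗ k, provided ε_A ⊗ Y
splits (`EvaluationSplits.exists_eq_whiskerLeft`), and f is the transpose of k. The splitting is
available once m or n is nonzero. -/

namespace RibbonCategory

section Currying

variable {C : Type u} [Category.{v} C] [MonoidalCategory C] [RightRigidCategory C] {A : C}

/-! ### Currying -/

/-- Uncurrying `(g ⊗ A) ; app`. -/
def uncur (φ : A ⊗ (Aᘁ : C) ≅ A) {X : C} (g : X ⟶ A) : X ⊗ A ⟶ A := g ▷ A ≫ app φ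

/-- `n`-fold uncurrying `(g ⊗ A^{⊗n}) ; app_n`. -/
def uncurN (φ : A ⊗ (Aᘁ : C) ≅ A) (n : ℕ) {X : C} (g : X ⟶ A) : X ⊗ tpow A n ⟶ A :=
  g ▷ tpow A n ≫ appN φ n

theorem comp_cur (φ : A ⊗ (Aᘁ : C) ≅ A) {X Y : C} (g : X ⟶ Y) (f : Y ⊗ A ⟶ A) :
    g ≫ cur φ f = cur φ (g ▷ A ≫ f) := by
  simp only [cur, comp_whiskerRight, Category.assoc]
  rw [← associator_inv_naturality_left_assoc, whisker_exchange_assoc,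
    rightUnitor_inv_naturality_assoc]

theorem uncur_comp (φ : A ⊗ (Aᘁ : C) ≅ A) {X Y : C} (g : X ⟶ Y) (f : Y ⟶ A) :
    uncur φ (g ≫ f) = g ▷ A ≫ uncur φ f := by
  simp [uncur]

theorem uncurN_comp (φ : A ⊗ (Aᘁ : C) ≅ A) (n : ℕ) {X Y : C} (g : X ⟶ Y) (f : Y ⟶ A) :
    uncurN φ n (g ≫ f) = g ▷ tpow A n ≫ uncurN φ n f := by
  simp [uncurN]

theorem cur_uncur (φ : A ⊗ (Aᘁ : C) ≅ A) {X : C} (g : X ⟶ A) : cur φ (uncur φ g) = g := by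
  -- By naturality of `cur` the universal case g = id suffices; it is the snake equation for A*.
  have h : cur φ (app φ) = 𝟙 A := by
    have := ExactPairing.evaluation_coevaluation A (Aᘁ)
    simp only [cur, app, comp_whiskerRight, Category.assoc]
    rw [← associator_inv_naturality_left_assoc, whisker_exchange_assoc,
      ← rightUnitor_inv_naturality_assoc]
    have h2 : (ρ_ (A ⊗ (Aᘁ : C))).inv ≫ (A ⊗ (Aᘁ : C)) ◁ η_ A (Aᘁ) ≫ (α_ _ A (Aᘁ)).inv ≫
        (α_ A (Aᘁ) A).hom ▷ (Aᘁ) ≫ (A ◁ ε_ A (Aᘁ)) ▷ (Aᘁ) ≫ (ρ_ A).hom ▷ (Aᘁ) =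
        A ◁ ((ρ_ _).inv ≫ (Aᘁ) ◁ η_ A (Aᘁ) ≫ (α_ (Aᘁ) A (Aᘁ)).inv ≫ ε_ A (Aᘁ) ▷ (Aᘁ) ≫
          (λ_ _).hom) := by
      monoidal
    rw [reassoc_of% h2]
    rw [ExactPairing.coevaluation_evaluation_assoc]
    simp
  rw [uncur, ← comp_cur, h, Category.comp_id]

theorem uncur_cur (φ : A ⊗ (Aᘁ : C) ≅ A) {X : C} (f : X ⊗ A ⟶ A) : uncur φ (cur φ f) = f := by
  simp only [cur, uncur, app, comp_whiskerRight, Category.assoc, hom_inv_whiskerRight_assoc]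
  have h : (ρ_ X).inv ▷ A ≫ (X ◁ η_ A (Aᘁ)) ▷ A ≫ (α_ X A (Aᘁ)).inv ▷ A ≫
      f ▷ (Aᘁ) ▷ A ≫ (α_ A (Aᘁ) A).hom ≫ A ◁ ε_ A (Aᘁ) ≫ (ρ_ A).hom =
      X ◁ ((λ_ A).inv ≫ η_ A (Aᘁ) ▷ A ≫ (α_ A (Aᘁ) A).hom ≫ A ◁ ε_ A (Aᘁ) ≫ (ρ_ A).hom)
        ≫ f := by
    have : f ▷ (Aᘁ) ▷ A ≫ (α_ A (Aᘁ) A).hom ≫ A ◁ ε_ A (Aᘁ) ≫ (ρ_ A).hom =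
      (α_ _ (Aᘁ) A).hom ≫ (X ⊗ A) ◁ ε_ A (Aᘁ) ≫ (ρ_ _).hom ≫ f := by
        rw [associator_naturality_left_assoc, ← whisker_exchange_assoc, rightUnitor_naturality]
    rw [this]
    monoidal
  rw [h, ExactPairing.evaluation_coevaluation_assoc]
  simp

theorem uncurN_zero (φ : A ⊗ (Aᘁ : C) ≅ A) {X : C} (g : X ⟶ A) :
    uncurN φ 0 g = (ρ_ X).hom ≫ g := by
  simp only [uncurN, appN, tpow]
  exact rightUnitor_naturality g

theorem uncurN_succ (φ : A ⊗ (Aᘁ : C) ≅ A) (n : ℕ) {X : C} (g : X ⟶ A) :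
    uncurN φ (n + 1) g = (α_ X A (tpow A n)).inv ≫ uncurN φ n (uncur φ g) := by
  simp only [uncurN, uncur, appN, tpow, comp_whiskerRight, Category.assoc]
  rw [associator_inv_naturality_left_assoc]

theorem uncurN_bijective (φ : A ⊗ (Aᘁ : C) ≅ A) (n : ℕ) (X : C) :
    Function.Bijective (uncurN φ n : (X ⟶ A) → _) := by
  induction n generalizing X with
  | zero =>
    have : (uncurN φ 0 : (X ⟶ A) → _) = fun g => (ρ_ X).hom ≫ g :=
      funext fun g => uncurN_zero φ g
    rw [this]
    exact ((ρ_ X).symm.homFromEquiv (Z := A)).bijective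
  | succ n ih =>
    have : (uncurN φ (n + 1) : (X ⟶ A) → _) =
        ((α_ X A (tpow A n)).homFromEquiv (Z := A)) ∘ (uncurN φ n) ∘ (uncur φ) :=
      funext fun g => uncurN_succ φ n g
    rw [this]
    refine (Equiv.bijective _).comp ((ih _).comp ?_)
    exact Function.bijective_iff_has_inverse.2 ⟨cur φ, cur_uncur φ, uncur_cur φ⟩

/-! ### The combinatory algebra as the monoid of endomorphisms of `A` -/

/-- The endomorphism `(a ⊗ A) ; app` of `A` represented by an element `a`. -/
def toEnd (φ : A ⊗ (Aᘁ : C) ≅ A) (a : 𝟙_ C ⟶ A) : A ⟶ A := (λ_ A).inv ≫ uncur φ a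

theorem toEnd_cur (φ : A ⊗ (Aᘁ : C) ≅ A) (f : 𝟙_ C ⊗ A ⟶ A) :
    toEnd φ (cur φ f) = (λ_ A).inv ≫ f := by
  rw [toEnd, uncur_cur]

theorem cur_toEnd (φ : A ⊗ (Aᘁ : C) ≅ A) (a : 𝟙_ C ⟶ A) :
    cur φ ((λ_ A).hom ≫ toEnd φ a) = a := by
  rw [toEnd, Iso.hom_inv_id_assoc, cur_uncur]

theorem toEnd_bijective (φ : A ⊗ (Aᘁ : C) ≅ A) : Function.Bijective (toEnd φ) :=
  Function.bijective_iff_has_inverse.2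
    ⟨fun f => cur φ ((λ_ A).hom ≫ f), cur_toEnd φ, fun f => by simp [toEnd_cur]⟩

theorem dot_eq (φ : A ⊗ (Aᘁ : C) ≅ A) (a b : 𝟙_ C ⟶ A) : dot φ a b = b ≫ toEnd φ a := by
  simp only [dot, toEnd, uncur, tensorHom_def', Category.assoc]
  rw [leftUnitor_inv_naturality_assoc]

theorem toEnd_combB (φ : A ⊗ (Aᘁ : C) ≅ A) :
    toEnd φ (combB φ) = cur φ (cur φ ((α_ A A A).hom ≫ A ◁ app φ ≫ app φ)) := by
  rw [combB, toEnd_cur, comp_cur, comp_cur]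
  simp

theorem toEnd_dot_combB (φ : A ⊗ (Aᘁ : C) ≅ A) (a : 𝟙_ C ⟶ A) :
    toEnd φ (dot φ (combB φ) a) = cur φ (app φ ≫ toEnd φ a) := by
  rw [dot_eq, toEnd_combB, comp_cur, toEnd_cur, comp_cur, comp_cur]
  congr 1
  simp only [toEnd, uncur]
  rw [leftUnitor_inv_naturality_assoc, whisker_exchange_assoc]
  monoidal

theorem toEnd_circ (φ : A ⊗ (Aᘁ : C) ≅ A) (a b : 𝟙_ C ⟶ A) :
    toEnd φ (circ φ a b) = toEnd φ b ≫ toEnd φ a := by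
  rw [circ, dot_eq, toEnd_dot_combB, comp_cur, toEnd_cur]
  simp only [toEnd, uncur, Category.assoc]

theorem toEnd_bullet (φ : A ⊗ (Aᘁ : C) ≅ A) (a : 𝟙_ C ⟶ A) :
    toEnd φ (bullet φ a) = (ρ_ A).inv ≫ A ◁ a ≫ app φ := by
  rw [bullet, toEnd_cur]
  simp

/-- B^n is n-ary composition: B^n x y z₁ … zₙ = x (y z₁ … zₙ). -/
theorem uncurN_uncur_toEnd_power_combB (φ : A ⊗ (Aᘁ : C) ≅ A) (n : ℕ) :
    uncurN φ n (uncur φ (toEnd φ (power φ (combB φ) n))) =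
      (α_ A A (tpow A n)).hom ≫ A ◁ appN φ n ≫ app φ := by
  induction n with
  | zero =>
    rw [power, combI, toEnd_cur, Iso.inv_hom_id, uncurN_zero]
    simp [uncur, appN, tpow]
  | succ n ih =>
    have h : uncur φ (uncur φ (toEnd φ (power φ (combB φ) (n + 1)))) =
        (α_ A A A).hom ≫ A ◁ app φ ≫ uncur φ (toEnd φ (power φ (combB φ) n)) := by
      rw [power, toEnd_circ, uncur_comp, uncur_comp, toEnd_combB, uncur_cur, uncur_cur,
        associator_naturality_left_assoc, ← whisker_exchange_assoc, uncur]
    rw [uncurN_succ, h, uncurN_comp, uncurN_comp, ih]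
    simp only [appN, tpow]
    monoidal

/-- An element has arity `m → n` when the map `A ⊗ A^{⊗m} ⟶ A` that it represents commutes with
the action of `A` on itself by composition with `n`-ary functions. -/
theorem mem_internalHom_iff (φ : A ⊗ (Aᘁ : C) ≅ A) (m n : ℕ) (a : 𝟙_ C ⟶ A) :
    a ∈ internalHom φ m n ↔
      A ◁ uncurN φ m (toEnd φ a) ≫ app φ = (α_ A A (tpow A m)).inv ≫
        uncur φ (toEnd φ (power φ (combB φ) n)) ▷ tpow A m ≫ uncurN φ m (toEnd φ a) := by
  -- Both sides are compared on x, w, z₁, …, zₘ. The left one is B^(m+1) x a w z₁ … zₘ = x (a w z₁ …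
  -- zₘ), whence m + 1.
  have inj : Function.Injective (fun g : A ⟶ A => uncurN φ (m + 1) g) :=
    (uncurN_bijective φ (m + 1) A).injective
  rw [internalHom, Set.mem_ofPred_eq, ← (toEnd_bijective φ).injective.eq_iff, ← inj.eq_iff]
  simp only [toEnd_circ, toEnd_bullet, toEnd_dot_combB]
  have h1 : uncurN φ (m + 1) (toEnd φ (power φ (combB φ) n) ≫ cur φ (app φ ≫ toEnd φ a)) =
      (α_ A A (tpow A m)).inv ≫
        uncur φ (toEnd φ (power φ (combB φ) n)) ▷ tpow A m ≫ uncurN φ m (toEnd φ a) := by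
    rw [uncurN_succ, uncur_comp, uncur_cur, ← Category.assoc, uncurN_comp]
    rfl
  have h2 : uncurN φ (m + 1) (toEnd φ (power φ (combB φ) (m + 1)) ≫ (ρ_ A).inv ≫ A ◁ a ≫ app φ) =
      A ◁ uncurN φ m (toEnd φ a) ≫ app φ := by
    have h3 : toEnd φ (power φ (combB φ) (m + 1)) ≫ (ρ_ A).inv ≫ A ◁ a ≫ app φ =
        ((ρ_ A).inv ≫ A ◁ a) ≫ uncur φ (toEnd φ (power φ (combB φ) (m + 1))) := by
      rw [uncur, Category.assoc, whisker_exchange_assoc, rightUnitor_inv_naturality_assoc]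
    rw [h3, uncurN_comp, uncurN_uncur_toEnd_power_combB]
    simp only [uncurN, toEnd, uncur, appN, tpow]
    monoidal
  rw [h1, h2]
  rfl

end Currying

/-! ### Maps commuting with left application -/

section Equivariant

variable {C : Type u} [Category.{v} C] [MonoidalCategory C] [RightRigidCategory C] {A : C}

/-- The map `ε_A ⊗ Y` is a split epimorphism. -/
def EvaluationSplits (A Y : C) : Prop :=
  ∃ s : Y ⟶ ((Aᘁ : C) ⊗ A) ⊗ Y, s ≫ ε_ A (Aᘁ) ▷ Y ≫ (λ_ Y).hom = 𝟙 Y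

theorem EvaluationSplits.rightDual (A : C) : EvaluationSplits A (Aᘁ : C) := by
  refine ⟨(ρ_ _).inv ≫ (Aᘁ : C) ◁ η_ A (Aᘁ) ≫ (α_ _ _ _).inv, ?_⟩
  have := ExactPairing.coevaluation_evaluation_assoc A (Aᘁ) (λ_ (Aᘁ : C)).hom
  simp only [Category.assoc, this]
  simp

theorem EvaluationSplits.of_retract {A Y Z : C} (h : EvaluationSplits A Z) (i : Y ⟶ Z)
    (r : Z ⟶ Y) (hir : i ≫ r = 𝟙 Y) : EvaluationSplits A Y := by
  obtain ⟨s, hs⟩ := h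
  refine ⟨i ≫ s ≫ ((Aᘁ : C) ⊗ A) ◁ r, ?_⟩
  rw [Category.assoc, Category.assoc, whisker_exchange_assoc, leftUnitor_naturality,
    reassoc_of% hs, hir]

theorem EvaluationSplits.tensor_right {A Y : C} (h : EvaluationSplits A Y) (Z : C) :
    EvaluationSplits A (Y ⊗ Z) := by
  obtain ⟨s, hs⟩ := h
  refine ⟨s ▷ Z ≫ (α_ _ _ _).hom, ?_⟩
  calc _ = (s ≫ ε_ A (Aᘁ) ▷ Y ≫ (λ_ Y).hom) ▷ Z := by monoidal
    _ = _ := by rw [hs, id_whiskerRight]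

theorem EvaluationSplits.tensor_left [BraidedCategory C] {A Y : C} (h : EvaluationSplits A Y)
    (Z : C) : EvaluationSplits A (Z ⊗ Y) :=
  (h.tensor_right Z).of_retract (β_ Z Y).hom (β_ Z Y).inv (Iso.hom_inv_id _)

theorem EvaluationSplits.self [BraidedCategory C] (φ : A ⊗ (Aᘁ : C) ≅ A) :
    EvaluationSplits A A :=
  ((EvaluationSplits.rightDual A).tensor_left A).of_retract φ.inv φ.hom φ.inv_hom_id

/-- By a snake equation, Y* is a retract of Y* ⊗ Y ⊗ Y*. -/
theorem EvaluationSplits.dual [BraidedCategory C] {Y : C} (h : EvaluationSplits A Y) :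
    EvaluationSplits A (Yᘁ : C) := by
  refine ((h.tensor_left (Yᘁ : C)).tensor_right (Yᘁ : C)).of_retract
    ((ρ_ _).inv ≫ (Yᘁ : C) ◁ η_ Y (Yᘁ) ≫ (α_ _ _ _).inv) (ε_ Y (Yᘁ) ▷ _ ≫ (λ_ _).hom) ?_
  have := ExactPairing.coevaluation_evaluation_assoc Y (Yᘁ) (λ_ (Yᘁ : C)).hom
  simp only [Category.assoc, this]
  simp

theorem EvaluationSplits.tpow [BraidedCategory C] (φ : A ⊗ (Aᘁ : C) ≅ A) {n : ℕ} (hn : n ≠ 0) :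
    EvaluationSplits A (tpow A n) := by
  obtain ⟨n, rfl⟩ := Nat.exists_eq_succ_of_ne_zero hn
  exact (EvaluationSplits.self φ).tensor_right _

/-- Capping A* ⊗ A ⊗ k with ε_A gives (ε_A ⊗ Y) ; k, and the split epimorphism cancels. -/
theorem EvaluationSplits.whiskerLeft_injective {Y : C} (hY : EvaluationSplits A Y) {k l : Y ⟶ 𝟙_ C}
    (h : A ◁ k = A ◁ l) : k = l := by
  obtain ⟨s, hs⟩ := hY
  have key (k : Y ⟶ 𝟙_ C) :
      k = s ≫ (α_ _ _ _).hom ≫ (Aᘁ : C) ◁ (A ◁ k ≫ (ρ_ A).hom) ≫ ε_ A (Aᘁ) :=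
    calc k = (s ≫ ε_ A (Aᘁ) ▷ Y ≫ (λ_ Y).hom) ≫ k := by rw [hs, Category.id_comp]
      _ = s ≫ (ε_ A (Aᘁ) ▷ Y ≫ 𝟙_ C ◁ k) ≫ (λ_ _).hom := by monoidal
      _ = s ≫ ((_ ◁ k ≫ ε_ A (Aᘁ) ▷ 𝟙_ C)) ≫ (λ_ _).hom := by rw [whisker_exchange]
      _ = _ := by monoidal
  rw [key k, key l, h]

/-- A map `A ⊗ Y ⟶ A` that commutes with application from the left is of the form `A ⊗ k`. -/
theorem EvaluationSplits.exists_eq_whiskerLeft (φ : A ⊗ (Aᘁ : C) ≅ A) {Y : C}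
    (hY : EvaluationSplits A Y) (h : A ⊗ Y ⟶ A)
    (hh : A ◁ h ≫ app φ = (α_ A A Y).inv ≫ app φ ▷ Y ≫ h) :
    ∃ k : Y ⟶ 𝟙_ C, h = A ◁ k ≫ (ρ_ A).hom := by
  obtain ⟨s, hs⟩ := hY
  have happ : φ.hom ▷ A ≫ app φ = (α_ A (Aᘁ) A).hom ≫ A ◁ ε_ A (Aᘁ) ≫ (ρ_ A).hom := by
    simp [app]
  -- This is `hh` precomposed with φ, which turns `app` into A ⊗ ε_A; precomposing with the section
  -- `s` then isolates `h`.
  have key : A ◁ ((Aᘁ : C) ◁ h ≫ ε_ A (Aᘁ)) ≫ (ρ_ A).hom =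
      A ◁ ((α_ _ _ _).inv ≫ ε_ A (Aᘁ) ▷ Y ≫ (λ_ Y).hom) ≫ h :=
    calc _ = (α_ _ _ _).inv ≫ _ ◁ h ≫ (α_ A (Aᘁ) A).hom ≫ A ◁ ε_ A (Aᘁ) ≫ (ρ_ A).hom := by
          monoidal
      _ = (α_ _ _ _).inv ≫ φ.hom ▷ (A ⊗ Y) ≫ A ◁ h ≫ app φ := by
          rw [← happ, whisker_exchange_assoc]
      _ = (α_ _ _ _).inv ≫ (α_ _ A Y).inv ≫ (φ.hom ▷ A ≫ app φ) ▷ Y ≫ h := by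
          rw [hh]; monoidal
      _ = _ := by
          rw [happ]; monoidal
  refine ⟨s ≫ (α_ _ _ _).hom ≫ (Aᘁ : C) ◁ h ≫ ε_ A (Aᘁ), ?_⟩
  calc h = A ◁ (s ≫ ε_ A (Aᘁ) ▷ Y ≫ (λ_ Y).hom) ≫ h := by
        rw [hs, whiskerLeft_id, Category.id_comp]
    _ = A ◁ s ≫ A ◁ (α_ _ _ _).hom ≫
          A ◁ ((α_ _ _ _).inv ≫ ε_ A (Aᘁ) ▷ Y ≫ (λ_ Y).hom) ≫ h := by simp
    _ = _ := by rw [← key]; simp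

/-- The canonical map `A ⊗ (A^{⊗n})* ⟶ A`. -/
theorem exists_uncurN_eq_evaluation (φ : A ⊗ (Aᘁ : C) ≅ A) (n : ℕ) :
    ∃ Φ : A ⊗ ((tpow A n)ᘁ : C) ⟶ A,
      uncurN φ n Φ = (α_ _ _ _).hom ≫ A ◁ ε_ (tpow A n) ((tpow A n)ᘁ) ≫ (ρ_ A).hom :=
  (uncurN_bijective φ n _).surjective _

theorem exists_section_of_uncurN_eq_evaluation (φ : A ⊗ (Aᘁ : C) ≅ A) (n : ℕ)
    (Φ : A ⊗ ((tpow A n)ᘁ : C) ⟶ A)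
    (hΦ : uncurN φ n Φ = (α_ _ _ _).hom ≫ A ◁ ε_ (tpow A n) ((tpow A n)ᘁ) ≫ (ρ_ A).hom) :
    ∃ Ψ : A ⟶ A ⊗ ((tpow A n)ᘁ : C), Ψ ≫ Φ = 𝟙 A := by
  refine ⟨(ρ_ _).inv ≫ A ◁ η_ (tpow A n) ((tpow A n)ᘁ) ≫ (α_ _ _ _).inv ≫ appN φ n ▷ _,
    (uncurN_bijective φ n A).injective ?_⟩
  rw [uncurN_comp, hΦ]
  set T := tpow A n
  calc _ = (ρ_ A).inv ▷ T ≫ (A ◁ η_ T (Tᘁ)) ▷ T ≫ (α_ _ _ _).inv ▷ T ≫ (α_ _ _ _).hom ≫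
        (appN φ n ▷ ((Tᘁ : C) ⊗ T) ≫ A ◁ ε_ T (Tᘁ)) ≫ (ρ_ A).hom := by monoidal
    _ = (ρ_ A).inv ▷ T ≫ (A ◁ η_ T (Tᘁ)) ▷ T ≫ (α_ _ _ _).inv ▷ T ≫ (α_ _ _ _).hom ≫
        (_ ◁ ε_ T (Tᘁ) ≫ appN φ n ▷ _) ≫ (ρ_ A).hom := by rw [whisker_exchange]
    _ = A ◁ ((λ_ T).inv ≫ η_ T (Tᘁ) ▷ T ≫ (α_ T (Tᘁ) T).hom ≫ T ◁ ε_ T (Tᘁ) ≫ (ρ_ T).hom) ≫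
        appN φ n := by monoidal
    _ = uncurN φ n (𝟙 A) := by
        rw [ExactPairing.evaluation_coevaluation_assoc]
        simp [uncurN, T]

/-- Precomposition with Φ replaces app_n by evaluation, leaving A tensored with the transpose of
`f`. -/
theorem whiskerRight_comp_appN (φ : A ⊗ (Aᘁ : C) ≅ A) {n : ℕ} {X : C} (f : X ⟶ tpow A n)
    (Φ : A ⊗ ((tpow A n)ᘁ : C) ⟶ A)
    (hΦ : uncurN φ n Φ = (α_ _ _ _).hom ≫ A ◁ ε_ (tpow A n) ((tpow A n)ᘁ) ≫ (ρ_ A).hom) :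
    Φ ▷ X ≫ A ◁ f ≫ appN φ n =
      (α_ _ _ _).hom ≫ A ◁ (((tpow A n)ᘁ : C) ◁ f ≫ ε_ (tpow A n) ((tpow A n)ᘁ)) ≫
        (ρ_ A).hom := by
  rw [← whisker_exchange_assoc]
  change _ ≫ uncurN φ n Φ = _
  rw [hΦ]
  monoidal

theorem evaluation_transpose {T X : C} (f : X ⟶ T) :
    f = (λ_ X).inv ≫ η_ T (Tᘁ) ▷ X ≫ (α_ _ _ _).hom ≫ T ◁ ((Tᘁ : C) ◁ f ≫ ε_ T (Tᘁ)) ≫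
      (ρ_ T).hom :=
  calc f = f ≫ (λ_ T).inv ≫ ((λ_ T).hom ≫ (ρ_ T).inv) ≫ (ρ_ T).hom := by simp
    _ = (λ_ X).inv ≫ (𝟙_ C ◁ f ≫ η_ T (Tᘁ) ▷ T) ≫ (α_ _ _ _).hom ≫ T ◁ ε_ T (Tᘁ) ≫
        (ρ_ T).hom := by
      rw [← ExactPairing.evaluation_coevaluation T (Tᘁ)]; monoidal
    _ = (λ_ X).inv ≫ (η_ T (Tᘁ) ▷ X ≫ _ ◁ f) ≫ (α_ _ _ _).hom ≫ T ◁ ε_ T (Tᘁ) ≫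
        (ρ_ T).hom := by rw [whisker_exchange]
    _ = _ := by monoidal

theorem exists_transpose {T X : C} (k : (Tᘁ : C) ⊗ X ⟶ 𝟙_ C) :
    ∃ f : X ⟶ T, (Tᘁ : C) ◁ f ≫ ε_ T (Tᘁ) = k := by
  refine ⟨(λ_ X).inv ≫ η_ T (Tᘁ) ▷ X ≫ (α_ _ _ _).hom ≫ T ◁ k ≫ (ρ_ T).hom, ?_⟩
  calc _ = (Tᘁ : C) ◁ (λ_ X).inv ≫ (Tᘁ : C) ◁ η_ T (Tᘁ) ▷ X ≫ (Tᘁ : C) ◁ (α_ _ _ _).hom ≫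
        (α_ _ _ _).inv ≫ (((Tᘁ : C) ⊗ T) ◁ k ≫ ε_ T (Tᘁ) ▷ 𝟙_ C) ≫ (ρ_ _).hom := by monoidal
    _ = (Tᘁ : C) ◁ (λ_ X).inv ≫ (Tᘁ : C) ◁ η_ T (Tᘁ) ▷ X ≫ (Tᘁ : C) ◁ (α_ _ _ _).hom ≫
        (α_ _ _ _).inv ≫ (ε_ T (Tᘁ) ▷ _ ≫ _ ◁ k) ≫ (ρ_ _).hom := by rw [whisker_exchange]
    _ = (Tᘁ : C) ◁ (λ_ X).inv ≫ (α_ _ _ _).inv ≫ (((Tᘁ : C) ◁ η_ T (Tᘁ) ≫ (α_ _ _ _).inv ≫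
        ε_ T (Tᘁ) ▷ (Tᘁ : C)) ▷ X) ≫ (α_ _ _ _).hom ≫ (λ_ _).hom ≫ k := by monoidal
    _ = _ := by rw [ExactPairing.coevaluation_evaluation]; monoidal

theorem evaluationSplits_dual_tensor [BraidedCategory C] (φ : A ⊗ (Aᘁ : C) ≅ A) {m n : ℕ}
    (hmn : m ≠ 0 ∨ n ≠ 0) : EvaluationSplits A (((tpow A n)ᘁ : C) ⊗ tpow A m) := by
  obtain h | h := hmn
  · exact (EvaluationSplits.tpow φ h).tensor_left _
  · exact (EvaluationSplits.tpow φ h).dual.tensor_right _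

theorem whiskerLeft_comp_appN_injective [BraidedCategory C] (φ : A ⊗ (Aᘁ : C) ≅ A) {m n : ℕ}
    (hmn : m ≠ 0 ∨ n ≠ 0) {f g : tpow A m ⟶ tpow A n}
    (h : A ◁ f ≫ appN φ n = A ◁ g ≫ appN φ n) : f = g := by
  obtain ⟨Φ, hΦ⟩ := exists_uncurN_eq_evaluation φ n
  have h1 := whiskerRight_comp_appN φ f Φ hΦ
  rw [h, whiskerRight_comp_appN φ g Φ hΦ, Iso.cancel_iso_hom_left, Iso.cancel_iso_hom_right] at h1
  rw [evaluation_transpose f, evaluation_transpose g,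
    (evaluationSplits_dual_tensor φ hmn).whiskerLeft_injective h1]

theorem mem_internalHom_of_eq (φ : A ⊗ (Aᘁ : C) ≅ A) {m n : ℕ} (a : 𝟙_ C ⟶ A)
    (f : tpow A m ⟶ tpow A n) (ha : uncurN φ m (toEnd φ a) = A ◁ f ≫ appN φ n) :
    a ∈ internalHom φ m n := by
  rw [mem_internalHom_iff, ha, ← whisker_exchange_assoc]
  change _ = _ ≫ _ ≫ uncurN φ n _
  rw [uncurN_uncur_toEnd_power_combB]
  monoidal

theorem exists_eq_of_mem_internalHom [BraidedCategory C] (φ : A ⊗ (Aᘁ : C) ≅ A) {m n : ℕ}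
    (hmn : m ≠ 0 ∨ n ≠ 0) (a : 𝟙_ C ⟶ A) (ha : a ∈ internalHom φ m n) :
    ∃ f : tpow A m ⟶ tpow A n, uncurN φ m (toEnd φ a) = A ◁ f ≫ appN φ n := by
  obtain ⟨Φ, hΦ⟩ := exists_uncurN_eq_evaluation φ n
  obtain ⟨Ψ, hΨ⟩ := exists_section_of_uncurN_eq_evaluation φ n Φ hΦ
  rw [mem_internalHom_iff] at ha
  -- Φ carries left application to the action of B^n.
  have hcomm : A ◁ Φ ≫ uncur φ (toEnd φ (power φ (combB φ) n)) =
      (α_ _ _ _).inv ≫ app φ ▷ _ ≫ Φ := by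
    apply (uncurN_bijective φ n _).injective
    rw [uncurN_comp, uncurN_uncur_toEnd_power_combB, uncurN_comp, uncurN_comp, hΦ,
      associator_naturality_middle_assoc, ← whiskerLeft_comp_assoc]
    change _ ≫ A ◁ uncurN φ n Φ ≫ _ = _
    rw [hΦ]
    rw [associator_naturality_left_assoc, ← whisker_exchange_assoc]
    monoidal
  set t := uncurN φ m (toEnd φ a) with ht
  obtain ⟨k, hk⟩ := (evaluationSplits_dual_tensor φ hmn).exists_eq_whiskerLeft φ
    ((α_ _ _ _).inv ≫ Φ ▷ _ ≫ t) (by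
      calc _ = A ◁ (α_ _ _ _).inv ≫ A ◁ Φ ▷ _ ≫ A ◁ t ≫ app φ := by monoidal
        _ = A ◁ (α_ _ _ _).inv ≫ (α_ _ _ _).inv ≫ (A ◁ Φ ≫
            uncur φ (toEnd φ (power φ (combB φ) n))) ▷ tpow A m ≫ t := by rw [ha]; monoidal
        _ = _ := by rw [hcomm]; monoidal)
  obtain ⟨f, rfl⟩ := exists_transpose k
  refine ⟨f, ?_⟩
  have h1 : Φ ▷ tpow A m ≫ t = Φ ▷ tpow A m ≫ A ◁ f ≫ appN φ n := by
    rw [whiskerRight_comp_appN φ f Φ hΦ, ← hk, Iso.hom_inv_id_assoc]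
  -- The section Ψ cancels Φ.
  have h2 := congrArg (fun x => Ψ ▷ tpow A m ≫ x) h1
  simpa only [← comp_whiskerRight_assoc, hΨ, id_whiskerRight, Category.id_comp] using h2

end Equivariant

/-! ### Sliding a strand across an element -/

section Braided

variable {C : Type u} [Category.{v} C] [MonoidalCategory C] [BraidedCategory C]

theorem leftUnitor_inv_comp_whiskerRight_braiding {Q X Y : C} (p : 𝟙_ C ⟶ Q ⊗ Y) :
    (λ_ X).inv ≫ p ▷ X ≫ (α_ _ _ _).hom ≫ Q ◁ (β_ Y X).hom =
      (ρ_ X).inv ≫ X ◁ p ≫ (α_ _ _ _).inv ≫ (β_ Q X).inv ▷ Y ≫ (α_ _ _ _).hom := by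
  have h := BraidedCategory.braiding_naturality_left p X
  rw [BraidedCategory.braiding_tensor_left_hom, braiding_tensorUnit_left] at h
  have h2 := congrArg (fun x => (λ_ X).inv ≫ x ≫ (α_ _ _ _).inv ≫ (β_ Q X).inv ▷ Y ≫
    (α_ _ _ _).hom) h
  simpa using h2

theorem leftUnitor_inv_comp_whiskerRight_braiding_inv {Q X Y : C} (e : 𝟙_ C ⟶ X ⊗ Y) :
    (λ_ Q).inv ≫ e ▷ Q ≫ (α_ _ _ _).hom ≫ X ◁ (β_ Q Y).inv =
      (ρ_ Q).inv ≫ Q ◁ e ≫ (α_ _ _ _).inv ≫ (β_ Q X).hom ▷ Y ≫ (α_ _ _ _).hom := by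
  have h := BraidedCategory.braiding_naturality_right Q e
  rw [BraidedCategory.braiding_tensor_right_hom, braiding_tensorUnit_right] at h
  have h2 := congrArg (fun x => (ρ_ Q).inv ≫ x ≫ (α_ _ _ _).hom ≫ X ◁ (β_ Q Y).inv) h
  simpa using h2.symm

end Braided

section Ribbon

variable {C : Type u} [Category.{v} C] [MonoidalCategory C] [BraidedCategory C]
  [RightRigidCategory C] [RibbonCategory C] {A : C}

/-! ### The twist -/

theorem θ_naturality {X Y : C} (f : X ⟶ Y) : f ≫ (θ Y).hom = (θ X).hom ≫ f :=
  BalancedMonoidalCategory.twist_naturality f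

theorem θ_tensor (X Y : C) :
    (θ (X ⊗ Y)).hom = (β_ X Y).hom ≫ ((θ Y).hom ⊗ₘ (θ X).hom) ≫ (β_ Y X).hom :=
  BalancedMonoidalCategory.twist_tensor X Y

/-- Naturality along λ_I and the balance axiom give θ_I = θ_I ; θ_I, and θ_I is invertible. -/
theorem θ_unit : (θ (𝟙_ C)).hom = 𝟙 _ := by
  have h := θ_naturality (λ_ (𝟙_ C)).hom
  rw [θ_tensor, braiding_tensorUnit_left, MonoidalCategory.tensorHom_def] at h
  simp [unitors_equal, unitors_inv_equal] at h
  exact ((cancel_epi (θ (𝟙_ C)).hom).1 ((Category.comp_id _).trans h)).symm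

theorem element_comp_twist {X : C} (p : 𝟙_ C ⟶ X) : p ≫ (θ X).hom = p := by
  rw [θ_naturality, θ_unit, Category.id_comp]

theorem coevaluation_twist (A : C) :
    η_ A (Aᘁ) ≫ (θ A).hom ▷ (Aᘁ : C) = η_ A (Aᘁ) ≫ A ◁ (θ (Aᘁ : C)).hom := by
  rw [← coevaluation_comp_rightAdjointMate]
  congr 2
  exact RibbonCategory.twist_dual A

omit [BraidedCategory C] [RibbonCategory C] in
/-- An element of `Q ⊗ A*` is recovered from its transpose `A ⟶ Q`. -/
theorem coevaluation_comp_transpose {A Q : C} (q : 𝟙_ C ⟶ Q ⊗ (Aᘁ : C)) :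
    η_ A (Aᘁ) ≫ ((λ_ A).inv ≫ q ▷ A ≫ (α_ _ _ _).hom ≫ Q ◁ ε_ A (Aᘁ) ≫ (ρ_ Q).hom) ▷ (Aᘁ : C) =
      q :=
  calc _ = (λ_ _).inv ≫ (𝟙_ C ◁ η_ A (Aᘁ) ≫ q ▷ _) ≫ (α_ _ _ _).hom ≫
        Q ◁ ((α_ _ _ _).inv ≫ ε_ A (Aᘁ) ▷ (Aᘁ : C) ≫ (λ_ _).hom) := by monoidal
    _ = (λ_ _).inv ≫ (q ▷ _ ≫ _ ◁ η_ A (Aᘁ)) ≫ (α_ _ _ _).hom ≫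
        Q ◁ ((α_ _ _ _).inv ≫ ε_ A (Aᘁ) ▷ (Aᘁ : C) ≫ (λ_ _).hom) := by rw [whisker_exchange]
    _ = q ≫ (ρ_ _).inv ≫ (α_ _ _ _).hom ≫ Q ◁ (((Aᘁ : C) ◁ η_ A (Aᘁ) ≫ (α_ _ _ _).inv ≫
        ε_ A (Aᘁ) ▷ (Aᘁ : C)) ≫ (λ_ _).hom) := by monoidal
    _ = _ := by rw [ExactPairing.coevaluation_evaluation]; monoidal

/-- Every such `q` is η_A ; (u ⊗ A*), so naturality reduces the claim to η_A, where it is (θ_A)* =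
θ_{A*}. -/
theorem element_comp_twist_whiskerRight {A Q : C} (q : 𝟙_ C ⟶ Q ⊗ (Aᘁ : C)) :
    q ≫ (θ Q).hom ▷ (Aᘁ : C) = q ≫ Q ◁ (θ (Aᘁ : C)).hom := by
  obtain ⟨u, rfl⟩ : ∃ u : A ⟶ Q, η_ A (Aᘁ) ≫ u ▷ (Aᘁ : C) = q := ⟨_, coevaluation_comp_transpose q⟩
  rw [Category.assoc, Category.assoc, ← comp_whiskerRight, θ_naturality, comp_whiskerRight,
    reassoc_of% coevaluation_twist A, whisker_exchange]

/-! ### Rotation of elements -/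

/-- Rotation of an element of `Q ⊗ X` to an element of `X ⊗ Q`. -/
def rotate {Q X : C} (p : 𝟙_ C ⟶ Q ⊗ X) : 𝟙_ C ⟶ X ⊗ Q :=
  p ≫ Q ◁ (θ X).hom ≫ (β_ Q X).hom

theorem rotate_naturality {Q X Y : C} (p : 𝟙_ C ⟶ Q ⊗ X) (f : X ⟶ Y) :
    rotate (p ≫ Q ◁ f) = rotate p ≫ f ▷ Q := by
  simp only [rotate, Category.assoc]
  rw [← BraidedCategory.braiding_naturality_right, ← whiskerLeft_comp_assoc, θ_naturality,
    whiskerLeft_comp_assoc]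

/-- Rotating Y and then X agrees with rotating X ⊗ Y by the balance axiom for θ_{X ⊗ Y}. -/
theorem rotate_tensor {Q X Y : C} (q : 𝟙_ C ⟶ Q ⊗ (X ⊗ Y)) :
    rotate q = rotate (rotate (q ≫ (α_ _ _ _).inv) ≫ (α_ _ _ _).inv) ≫ (α_ _ _ _).inv := by
  have h : (α_ Q X Y).inv ≫ (Q ⊗ X) ◁ (θ Y).hom ≫ (β_ (Q ⊗ X) Y).hom ≫ (α_ _ _ _).inv ≫
      (Y ⊗ Q) ◁ (θ X).hom ≫ (β_ (Y ⊗ Q) X).hom ≫ (α_ _ _ _).inv =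
      Q ◁ ((β_ X Y).hom ≫ ((θ Y).hom ⊗ₘ (θ X).hom) ≫ (β_ Y X).hom) ≫ (β_ Q (X ⊗ Y)).hom :=
    calc _ = Q ◁ (X ◁ (θ Y).hom ≫ (β_ X Y).hom) ≫ (α_ _ _ _).inv ≫
          ((β_ Q Y).hom ▷ X ≫ _ ◁ (θ X).hom) ≫ (α_ _ _ _).hom ≫ Y ◁ (β_ Q X).hom ≫
          (α_ _ _ _).inv ≫ (β_ Y X).hom ▷ Q := by
          rw [BraidedCategory.braiding_tensor_left_hom, BraidedCategory.braiding_tensor_left_hom]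
          monoidal
      _ = Q ◁ ((β_ X Y).hom ≫ ((θ Y).hom ⊗ₘ (θ X).hom)) ≫ (β_ Q (Y ⊗ X)).hom ≫
          (β_ Y X).hom ▷ Q := by
          rw [← whisker_exchange, BraidedCategory.braiding_naturality_right,
            BraidedCategory.braiding_tensor_right_hom, MonoidalCategory.tensorHom_def]
          monoidal
      _ = _ := by
          rw [← BraidedCategory.braiding_naturality_right]
          simp only [whiskerLeft_comp, Category.assoc]
  rw [← θ_tensor] at h
  simp only [rotate, Category.assoc, ← h]

/-- The coevaluation `I ⟶ A* ⊗ A` of the other duality between `A` and `A*`. -/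
def coevaluationLeft (A : C) : 𝟙_ C ⟶ (Aᘁ : C) ⊗ A :=
  η_ A (Aᘁ) ≫ A ◁ (θ (Aᘁ : C)).inv ≫ (β_ (Aᘁ : C) A).inv

theorem rotate_rightDual {A Q : C} (q : 𝟙_ C ⟶ Q ⊗ (Aᘁ : C)) :
    rotate q = coevaluationLeft A ≫ (Aᘁ : C) ◁
      ((λ_ A).inv ≫ q ▷ A ≫ (α_ _ _ _).hom ≫ Q ◁ ε_ A (Aᘁ) ≫ (ρ_ Q).hom) := by
  have h := coevaluation_comp_transpose q
  set u := (λ_ A).inv ≫ q ▷ A ≫ (α_ _ _ _).hom ≫ Q ◁ ε_ A (Aᘁ) ≫ (ρ_ Q).hom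
  have h1 : coevaluationLeft A ≫ (Aᘁ : C) ◁ u =
      q ≫ Q ◁ (θ (Aᘁ : C)).inv ≫ (β_ (Aᘁ : C) Q).inv := by
    rw [← h]
    simp only [coevaluationLeft, Category.assoc]
    rw [← BraidedCategory.braiding_inv_naturality_left, whisker_exchange_assoc]
  rw [h1, ← Category.assoc q, Iso.eq_comp_inv, rotate]
  -- Expanding q ; θ_{Q ⊗ A*} = q and moving the twist of Q onto A* shows that a double braiding
  -- with two twists on A* fixes q. Hence σ with θ and σ⁻¹ with θ⁻¹ agree on q.
  have h2 := element_comp_twist q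
  rw [θ_tensor, ← BraidedCategory.braiding_naturality_assoc, MonoidalCategory.tensorHom_def,
    Category.assoc, reassoc_of% element_comp_twist_whiskerRight q] at h2
  conv_rhs => rw [← h2]
  simp

theorem trace_comp_whiskerRight {P Q R X : C} (f : P ⊗ X ⟶ Q ⊗ X) (g : Q ⟶ R) :
    trace X (f ≫ g ▷ X) = trace X f ≫ g := by
  simp only [trace, comp_whiskerRight, Category.assoc]
  rw [associator_naturality_left_assoc, ← whisker_exchange_assoc, rightUnitor_naturality]

theorem trace_whiskerLeft_element {A Q : C} (p : 𝟙_ C ⟶ Q ⊗ A) :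
    trace A ((λ_ A).hom ≫ (ρ_ A).inv ≫ A ◁ p ≫ (α_ _ _ _).inv) = rotate p := by
  set r := p ≫ Q ◁ (θ A).hom with hr
  calc _ = η_ A (Aᘁ) ≫ A ◁ (((λ_ _).inv ≫ p ▷ (Aᘁ : C) ≫ (α_ _ _ _).hom ≫ Q ◁ (β_ A (Aᘁ)).hom) ≫
        Q ◁ (Aᘁ : C) ◁ (θ A).hom ≫ Q ◁ ε_ A (Aᘁ) ≫ (ρ_ _).hom) := by
        simp only [trace]; monoidal
    _ = η_ A (Aᘁ) ≫ A ◁ ((ρ_ _).inv ≫ (Aᘁ : C) ◁ p ≫ (α_ _ _ _).inv ≫ ((β_ Q (Aᘁ)).inv ▷ A ≫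
        _ ◁ (θ A).hom) ≫ (α_ _ _ _).hom ≫ Q ◁ ε_ A (Aᘁ) ≫ (ρ_ _).hom) := by
        rw [leftUnitor_inv_comp_whiskerRight_braiding]; monoidal
    _ = (λ_ _).inv ≫ (η_ A (Aᘁ) ▷ 𝟙_ C ≫ _ ◁ r) ≫ (α_ _ _ _).hom ≫
        A ◁ ((α_ _ _ _).inv ≫ (β_ Q (Aᘁ)).inv ▷ A ≫ (α_ _ _ _).hom ≫ Q ◁ ε_ A (Aᘁ) ≫
          (ρ_ _).hom) := by
        rw [← whisker_exchange]; monoidal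
    _ = r ≫ ((λ_ Q).inv ≫ η_ A (Aᘁ) ▷ Q ≫ (α_ _ _ _).hom ≫ A ◁ (β_ Q (Aᘁ)).inv) ▷ A ≫
        (α_ _ _ _).hom ≫ A ◁ ((α_ _ _ _).hom ≫ Q ◁ ε_ A (Aᘁ) ≫ (ρ_ _).hom) := by
        rw [← whisker_exchange]; monoidal
    _ = r ≫ Q ◁ ((λ_ A).inv ≫ η_ A (Aᘁ) ▷ A ≫ (α_ _ _ _).hom) ≫
        (α_ _ _ _).inv ≫ ((β_ Q A).hom ▷ _ ≫ _ ◁ ε_ A (Aᘁ)) ≫ (ρ_ _).hom := by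
        rw [leftUnitor_inv_comp_whiskerRight_braiding_inv]; monoidal
    _ = r ≫ Q ◁ ((λ_ A).inv ≫ η_ A (Aᘁ) ▷ A ≫ (α_ _ _ _).hom ≫ A ◁ ε_ A (Aᘁ) ≫ (ρ_ _).hom) ≫
        (β_ Q A).hom := by
        rw [← whisker_exchange]; monoidal
    _ = _ := by
        rw [ExactPairing.evaluation_coevaluation_assoc, rotate, hr]; simp

/-! ### Abstraction by traces -/

theorem lam_eq (φ : A ⊗ (Aᘁ : C) ≅ A) :
    lam φ = (ρ_ A).inv ≫ A ◁ coevaluationLeft A ≫ (α_ A (Aᘁ) A).inv ≫ φ.hom ▷ A := rfl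

/-- The map `A ⟶ Q ⊗ A` obtained by applying the second component of an element of `Q ⊗ A`. -/
def applyElement (φ : A ⊗ (Aᘁ : C) ≅ A) {Q : C} (p : 𝟙_ C ⟶ Q ⊗ A) : A ⟶ Q ⊗ A :=
  (λ_ A).inv ≫ p ▷ A ≫ (α_ _ _ _).hom ≫ Q ◁ app φ

/-- `n`-fold application of the second component of an element of `Q ⊗ A`. -/
def applyElementN (φ : A ⊗ (Aᘁ : C) ≅ A) (n : ℕ) {Q : C} (p : 𝟙_ C ⟶ Q ⊗ A) :
    tpow A n ⟶ Q ⊗ A :=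
  (λ_ _).inv ≫ p ▷ tpow A n ≫ (α_ _ _ _).hom ≫ Q ◁ appN φ n

/-- Splitting A as A ⊗ A* through φ, the A* strand is rotated by bending, which produces the
application. One layer of `lam` thus absorbs one layer of `app`. -/
theorem rotate_applyElement (φ : A ⊗ (Aᘁ : C) ≅ A) {Q : C} (p : 𝟙_ C ⟶ Q ⊗ A) :
    rotate (coevaluationLeft A ≫ (Aᘁ : C) ◁ applyElement φ p ≫ (α_ _ _ _).inv) ≫
      (α_ _ _ _).inv ≫ φ.hom ▷ Q = rotate p := by
  have h : p = (p ≫ Q ◁ φ.inv) ≫ Q ◁ φ.hom := by simp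
  conv_rhs => rw [h, rotate_naturality, rotate_tensor, rotate_rightDual]
  simp only [Category.assoc]
  simp only [applyElement, app]
  congr 2
  monoidal

theorem trace_lamN_comp_applyElementN (φ : A ⊗ (Aᘁ : C) ≅ A) (n : ℕ) {Q : C}
    (p : 𝟙_ C ⟶ Q ⊗ A) :
    trace A ((λ_ A).hom ≫ lamN φ n ≫ A ◁ applyElementN φ n p ≫ (α_ _ _ _).inv) = rotate p := by
  induction n generalizing Q with
  | zero =>
    rw [← trace_whiskerLeft_element]
    congr 3
    simp only [applyElementN, appN, tpow]
    monoidal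
  | succ n ih =>
    -- The A* strand opened by `lam` joins Q, so the induction hypothesis is used at A* ⊗ Q.
    rw [← rotate_applyElement φ p, ← ih, ← trace_comp_whiskerRight]
    congr 1
    let T := tpow A n
    let x : A ⊗ T ⟶ Q ⊗ A := applyElement φ p ▷ T ≫ (α_ _ _ _).hom ≫ Q ◁ appN φ n
    have h1 : applyElementN φ (n + 1) p = x := by
      simp only [applyElementN, applyElement, appN, tpow, x, T]
      monoidal
    have h2 : applyElementN φ n (coevaluationLeft A ≫ (Aᘁ : C) ◁ applyElement φ p ≫
        (α_ _ _ _).inv) = (λ_ _).inv ≫ coevaluationLeft A ▷ T ≫ (α_ _ _ _).hom ≫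
          (Aᘁ : C) ◁ x ≫ (α_ _ _ _).inv := by
      simp only [applyElementN, x, T]
      monoidal
    rw [h1, h2]
    calc _ = (λ_ A).hom ≫ lamN φ n ≫ (ρ_ A).inv ▷ T ≫ (A ◁ coevaluationLeft A) ▷ T ≫
          (α_ A (Aᘁ) A).inv ▷ T ≫ (α_ _ _ _).hom ≫ (φ.hom ▷ (A ⊗ T) ≫ A ◁ x) ≫
          (α_ _ _ _).inv := by
          simp only [lamN, lam_eq, tpow]; monoidal
      _ = _ := by
          rw [← whisker_exchange]; monoidal

theorem trace_lamN_comp_uncurN (φ : A ⊗ (Aᘁ : C) ≅ A) (n : ℕ) (a : 𝟙_ C ⟶ A) :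
    trace A ((λ_ A).hom ≫ lamN φ n ≫ A ◁ ((λ_ _).inv ≫ uncurN φ n a)) = a := by
  have h := trace_lamN_comp_applyElementN φ n (a ≫ (λ_ A).inv)
  have h1 : rotate (a ≫ (λ_ A).inv) = a ≫ (ρ_ A).inv := by
    rw [rotate, Category.assoc, ← leftUnitor_inv_naturality_assoc,
      reassoc_of% element_comp_twist a, leftUnitor_inv_braiding]
  have h2 := congrArg (fun x => x ≫ (ρ_ A).hom) (h.trans h1)
  simp only [Category.assoc, Iso.inv_hom_id, Category.comp_id] at h2
  rw [← trace_comp_whiskerRight] at h2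
  refine Eq.trans ?_ h2
  congr 1
  simp only [applyElementN, uncurN]
  monoidal

omit [BraidedCategory C] [RibbonCategory C] in
theorem uncurN_toEnd (φ : A ⊗ (Aᘁ : C) ≅ A) (n : ℕ) (a : 𝟙_ C ⟶ A) :
    uncurN φ n (toEnd φ a) = (λ_ _).inv ≫ uncurN φ (n + 1) a := by
  rw [toEnd, uncurN_comp, uncurN_succ]
  monoidal

theorem uncurN_toEnd_mapF (φ : A ⊗ (Aᘁ : C) ≅ A) (m n : ℕ) (f : tpow A m ⟶ tpow A n) :
    uncurN φ m (toEnd φ (mapF φ m n f)) = A ◁ f ≫ appN φ n := by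
  -- The level is m + 1 because lam_m ; (lam ⊗ f) in `mapF` is lam_{m+1} followed by `f`.
  obtain ⟨a, ha⟩ := (uncurN_bijective φ (m + 1) _).surjective ((λ_ _).hom ≫ A ◁ f ≫ appN φ n)
  have h : mapF φ m n f = a := by
    rw [← trace_lamN_comp_uncurN φ (m + 1) a, ha, mapF]
    congr 2
    simp only [lamN]
    rw [MonoidalCategory.tensorHom_def]
    monoidal
  rw [h, uncurN_toEnd, ha, Iso.inv_hom_id_assoc]
  rfl

end Ribbon

end RibbonCategory


open RibbonCategory in
theorem mainTheorem5 {C : Type u} [Category.{v} C] [MonoidalCategory C] [BraidedCategory C]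
    [RightRigidCategory C] [RibbonCategory C] (A : C) (φ : A ⊗ (Aᘁ : C) ≅ A)
    (m n : ℕ) (hmn : m ≠ 0 ∨ n ≠ 0) :
    Set.BijOn (RibbonCategory.mapF φ m n) Set.univ (RibbonCategory.internalHom φ m n) := by
  refine ⟨fun f _ => mem_internalHom_of_eq φ _ f (uncurN_toEnd_mapF φ m n f), fun f _ g _ h => ?_,
    fun a ha => ?_⟩
  · apply whiskerLeft_comp_appN_injective φ hmn
    rw [← uncurN_toEnd_mapF, ← uncurN_toEnd_mapF, h]
  · obtain ⟨f, hf⟩ := exists_eq_of_mem_internalHom φ hmn a ha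
    refine ⟨f, trivial, (toEnd_bijective φ).injective ((uncurN_bijective φ m A).injective ?_)⟩
    rw [uncurN_toEnd_mapF, hf]
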